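/- A partition $\lambda=(\lambda_1\ge\cdots\ge\lambda_k>0)$ has length $k$ and size $|\lambda|=\lambda_1+\cdots+\lambda_k$. Partitions are ordered by containment of Young diagrams (Young's lattice), and $[\mu,\lambda]$ denotes an interval in this order; in particular $\#[\emptyset,\lambda]$ is the number of partitions whose Young diagram is contained in that of $\lambda$. For $k\ge 1$ and $n\ge k$ let $$A_{k,n}=\frac{\sum_{\lambda}\#[\emptyset,\lambda]}{\#\{\lambda\}},$$ where $\lambda$ runs over all partitions of length exactly $k$ and size $n$; that is, $A_{k,n}$ is the average cardinality of $[\emptyset,\lambda]$ over these partitions. Let $(k^k)=(k,k,\dots,k)$ be the partition with $k$ parts all equal to $k$, and put $$G_k=\frac{(k-1)!}{(2k-1)!}\sum_{\lambda\in[(k,k-1,\dots,2,1),\,(k^k)]}\ \prod_{i=1}^{k}\lambda_i^{-1}.$$ **Theorem.** Let $k\ge 1$ be fixed. Then $A_{k,n}\sim G_k\,n^k$ as $n\to\infty$, i.e. $\lim_{n\to\infty} A_{k,n}/(G_k n^k)=1$. -/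

import Mathlib

open Filter Asymptotics
open scoped Topology Nat

namespace YoungLattice

/-- Only finitely many Young diagrams fit inside a given finite set of cells. -/
theorem finite_cells_subset (s : Finset (ℕ × ℕ)) : {μ : YoungDiagram | μ.cells ⊆ s}.Finite := by
  have h : (s.powerset : Set (Finset (ℕ × ℕ))).Finite := Finset.finite_toSet _
  refine (h.preimage (f := YoungDiagram.cells) ?_).subset ?_
  · intro a _ b _ hab
    exact YoungDiagram.ext hab
  · intro μ hμ
    simpa using hμ

/-- Young's lattice (Young diagrams ordered by containment) is locally finite. -/
noncomputable instance : LocallyFiniteOrder YoungDiagram :=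
  LocallyFiniteOrder.ofFiniteIcc fun _ b =>
    (finite_cells_subset b.cells).subset fun _ hx => YoungDiagram.cells_subset_iff.2 hx.2

/-- The number of nonzero parts of a partition, i.e. the number of nonempty rows of its diagram. -/
def length (μ : YoungDiagram) : ℕ := μ.colLen 0

/-- There are only finitely many partitions of length `k` and size `n`. -/
theorem finite_partitions (k n : ℕ) : {μ : YoungDiagram | length μ = k ∧ μ.card = n}.Finite := by
  refine (finite_cells_subset (Finset.range n ×ˢ Finset.range n)).subset ?_
  rintro μ ⟨-, rfl⟩ ⟨i, j⟩ hc
  have hc' : (i, j) ∈ μ := hc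
  have h1 := YoungDiagram.mem_iff_lt_colLen.1 hc'
  have h2 := YoungDiagram.mem_iff_lt_rowLen.1 hc'
  rw [YoungDiagram.colLen_eq_card] at h1
  rw [YoungDiagram.rowLen_eq_card] at h2
  simp only [Finset.mem_product, Finset.mem_range]
  exact ⟨h1.trans_le (Finset.card_le_card (Finset.filter_subset _ _)),
    h2.trans_le (Finset.card_le_card (Finset.filter_subset _ _))⟩

/-- The finite set of partitions of length `k` (exactly `k` nonzero parts) and size `n`. -/
noncomputable def partitions (k n : ℕ) : Finset YoungDiagram := (finite_partitions k n).toFinset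

theorem mem_partitions {k n : ℕ} {μ : YoungDiagram} :
    μ ∈ partitions k n ↔ length μ = k ∧ μ.card = n := by
  simp [partitions]

/-- `A_{k,n}`: the average of `#[∅, μ]` over the partitions `μ` of length `k` and size `n`. -/
noncomputable def avgIdealCard (k n : ℕ) : ℝ :=
  (∑ μ ∈ partitions k n, ((Finset.Icc ⊥ μ).card : ℝ)) / ((partitions k n).card : ℝ)

/-- The staircase partition `(k, k - 1, …, 2, 1)`. -/
def staircase (k : ℕ) : YoungDiagram where
  cells := (Finset.range k ×ˢ Finset.range k).filter fun c => c.1 + c.2 < k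
  isLowerSet := by
    rintro ⟨a, b⟩ ⟨c, d⟩ ⟨h1, h2⟩ h
    simp only [Finset.coe_filter, Finset.mem_product, Finset.mem_range, Set.mem_ofPred_eq] at *
    omega

/-- The square partition `(k, k, …, k)` with `k` parts. -/
def square (k : ℕ) : YoungDiagram where
  cells := Finset.range k ×ˢ Finset.range k
  isLowerSet := by
    rintro ⟨a, b⟩ ⟨c, d⟩ ⟨h1, h2⟩ h
    simp only [Finset.coe_product, Finset.coe_range, Set.mem_prod, Set.mem_Iio] at *
    omega

/-- The parts of the staircase are `k, k - 1, …, 1` (rows are indexed from `0`). -/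
theorem rowLen_staircase (k i : ℕ) : (staircase k).rowLen i = k - i := by
  refine eq_of_forall_lt_iff fun j => ?_
  rw [← YoungDiagram.mem_iff_lt_rowLen, ← YoungDiagram.mem_cells]
  simp only [staircase, Finset.mem_filter, Finset.mem_product, Finset.mem_range]
  omega

/-- The first `k` parts of the square are all equal to `k`. -/
theorem rowLen_square {k i : ℕ} (hi : i < k) : (square k).rowLen i = k := by
  refine eq_of_forall_lt_iff fun j => ?_
  rw [← YoungDiagram.mem_iff_lt_rowLen, ← YoungDiagram.mem_cells]
  simp only [square, Finset.mem_product, Finset.mem_range]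
  omega

/-- The constant
`G_k = ((k-1)! / (2k-1)!) * ∑_{μ ∈ [(k,k-1,…,1), (k^k)]} ∏_{i=1}^k 1 / μ_i`. -/
noncomputable def growthConst (k : ℕ) : ℝ :=
  ((k - 1)! : ℝ) / ((2 * k - 1)! : ℝ) *
    ∑ μ ∈ Finset.Icc (staircase k) (square k), ∏ i ∈ Finset.range k, ((μ.rowLen i : ℝ))⁻¹

end YoungLattice

/-!
The numerator of the average counts pairs `μ ⊆ ν` of nested partitions with `|ν| = n` and `ν` of
length `k`. More generally, let `N p q n` be the number of nested pairs with `|ν| = n` in which `ν`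
has length at most `p` and `μ` has length at most `q`. If the lengths are exactly `p` and `q`, with
`1 ≤ q ≤ p`, then deleting the first column of both diagrams gives an arbitrary pair counted by
`N p q (n - p)`. Inclusion–exclusion over the remaining pairs yields
`N p q n - N p q (n - p) = N (p - 1) q n + N p (q - 1) n - N (p - 1) (q - 1) n`
(`card_nestedPairs_succ_succ`).

Since `N p q n` has order `n ^ (p + q - 1)`, the last term is negligible, and summing along steps of
length `p` (`tendsto_div_pow_succ`, a Stolz–Cesàro argument) shows by induction that
`N p q n ∼ c p q * n ^ (p + q - 1)` with
`p * (p + q - 1) * c p q = c (p - 1) q + c p (q - 1)`, where `c p q = 0` for `p < q`. After the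
normalisation `c p q = E p q / (p! * (p + q - 1)!)` this becomes
`E p q = E (p - 1) q + E p (q - 1) / p` with `E p 0 = 1`. The same recursion holds for the sum over
the diagrams between the staircase `(q, …, 1)` and the rectangle with `q` columns of height `p`,
weighted by the reciprocals of the column heights: split according to whether the first column has
height `p` (`staircaseSum_succ_succ`). Hence `E k k` is the sum in the growth constant, up to
transposition.

Prescribing the exact length `k` of `ν` subtracts only lower order terms, both for the pairs and,
with `q = 0`, for the partitions themselves, and the quotient of the two asymptotics is the claim.
-/

namespace YoungLattice

/-! ### Diagrams through their column lengths -/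

theorem le_iff_colLen {μ ν : YoungDiagram} : μ ≤ ν ↔ ∀ j, μ.colLen j ≤ ν.colLen j := by
  constructor
  · intro h j
    refine le_of_forall_lt fun i hi => ?_
    rw [← YoungDiagram.mem_iff_lt_colLen] at hi ⊢
    exact h hi
  · rintro h ⟨i, j⟩ hc
    have hc' : (i, j) ∈ μ := hc
    rw [YoungDiagram.mem_iff_lt_colLen] at hc'
    exact YoungDiagram.mem_iff_lt_colLen.2 (hc'.trans_le (h j))

theorem le_iff_rowLen {μ ν : YoungDiagram} : μ ≤ ν ↔ ∀ i, μ.rowLen i ≤ ν.rowLen i := by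
  rw [← YoungDiagram.transpose_le_iff, le_iff_colLen]
  simp only [YoungDiagram.colLen_transpose]

theorem ext_colLen {μ ν : YoungDiagram} (h : ∀ j, μ.colLen j = ν.colLen j) : μ = ν :=
  le_antisymm (le_iff_colLen.2 fun j => (h j).le) (le_iff_colLen.2 fun j => (h j).ge)

theorem colLen_le_colLen_zero (μ : YoungDiagram) (j : ℕ) : μ.colLen j ≤ μ.colLen 0 :=
  μ.colLen_anti 0 j (Nat.zero_le j)

theorem colLen_bot (j : ℕ) : (⊥ : YoungDiagram).colLen j = 0 := by
  by_contra h
  exact YoungDiagram.notMem_bot (0, j) (YoungDiagram.mem_iff_lt_colLen.2 (Nat.pos_of_ne_zero h))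

theorem eq_bot_iff_colLen_zero {μ : YoungDiagram} : μ = ⊥ ↔ μ.colLen 0 = 0 := by
  constructor
  · rintro rfl
    exact colLen_bot 0
  · intro h
    refine ext_colLen fun j => ?_
    rw [colLen_bot]
    exact Nat.le_zero.1 (h ▸ colLen_le_colLen_zero μ j)

/-- The diagram `μ` with its first column removed. -/
def dropCol (μ : YoungDiagram) : YoungDiagram where
  cells := (μ.cells.filter fun c => 0 < c.2).image fun c => (c.1, c.2 - 1)
  isLowerSet := by
    rintro ⟨a, b⟩ ⟨c, d⟩ ⟨h1, h2⟩ h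
    simp only [Finset.coe_image, Set.mem_image, Finset.mem_coe, Finset.mem_filter, Prod.exists,
      Prod.mk.injEq] at h ⊢
    obtain ⟨x, y, ⟨hxy, hy⟩, rfl, rfl⟩ := h
    simp only at h1 h2
    exact ⟨c, d + 1, ⟨μ.isLowerSet (show ((c, d + 1) : ℕ × ℕ) ≤ (x, y) from
      ⟨h1, by simp only; omega⟩) hxy, Nat.succ_pos d⟩, rfl, rfl⟩

/-- The diagram obtained from `μ` by putting a new column in front. Its height is `p`, raised to
the height of the first column of `μ` when `p` is smaller, so that the result is a diagram for
every `p`. -/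
def addCol (p : ℕ) (μ : YoungDiagram) : YoungDiagram where
  cells := (Finset.range (max p (μ.colLen 0))).image (fun i => (i, 0)) ∪
    μ.cells.image fun c => (c.1, c.2 + 1)
  isLowerSet := by
    rintro ⟨a, b⟩ ⟨c, d⟩ ⟨h1, h2⟩ h
    simp only [Finset.coe_union, Finset.coe_image, Set.mem_union, Set.mem_image, Finset.mem_coe,
      Finset.mem_range, Prod.mk.injEq, Prod.exists] at h ⊢
    simp only at h1 h2
    rcases h with ⟨x, hx, rfl, rfl⟩ | ⟨x, y, hx, rfl, rfl⟩
    · exact Or.inl ⟨c, by omega, rfl, by omega⟩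
    · rcases d with _ | d
      · have := YoungDiagram.mem_iff_lt_colLen.1 ((YoungDiagram.mem_cells _).1 hx)
        have := colLen_le_colLen_zero μ y
        exact Or.inl ⟨c, by omega, rfl, rfl⟩
      · exact Or.inr ⟨c, d, μ.isLowerSet (show ((c, d) : ℕ × ℕ) ≤ (x, y) from
          ⟨h1, by simpa using h2⟩) hx, rfl, rfl⟩

@[simp]
theorem colLen_dropCol (μ : YoungDiagram) (j : ℕ) : (dropCol μ).colLen j = μ.colLen (j + 1) := by
  refine eq_of_forall_lt_iff fun i => ?_
  rw [← YoungDiagram.mem_iff_lt_colLen, ← YoungDiagram.mem_iff_lt_colLen, ← YoungDiagram.mem_cells]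
  simp only [dropCol, Finset.mem_image, Finset.mem_filter, YoungDiagram.mem_cells, Prod.exists,
    Prod.mk.injEq]
  constructor
  · rintro ⟨a, b, ⟨h, hb⟩, rfl, rfl⟩
    rwa [Nat.sub_add_cancel hb]
  · exact fun h => ⟨i, j + 1, ⟨h, Nat.succ_pos j⟩, rfl, rfl⟩

@[simp]
theorem colLen_addCol_zero (p : ℕ) (μ : YoungDiagram) :
    (addCol p μ).colLen 0 = max p (μ.colLen 0) := by
  refine eq_of_forall_lt_iff fun i => ?_
  rw [← YoungDiagram.mem_iff_lt_colLen, ← YoungDiagram.mem_cells]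
  simp [addCol]

@[simp]
theorem colLen_addCol_succ (p : ℕ) (μ : YoungDiagram) (j : ℕ) :
    (addCol p μ).colLen (j + 1) = μ.colLen j := by
  refine eq_of_forall_lt_iff fun i => ?_
  rw [← YoungDiagram.mem_iff_lt_colLen, ← YoungDiagram.mem_iff_lt_colLen, ← YoungDiagram.mem_cells]
  simp [addCol]

theorem dropCol_addCol (p : ℕ) (μ : YoungDiagram) : dropCol (addCol p μ) = μ :=
  ext_colLen fun j => by simp

theorem addCol_dropCol {p : ℕ} {μ : YoungDiagram} (h : μ.colLen 0 = p) :
    addCol p (dropCol μ) = μ := by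
  refine ext_colLen fun j => ?_
  rcases j with _ | j
  · simpa [h] using h ▸ colLen_le_colLen_zero μ 1
  · simp

theorem card_addCol {p : ℕ} {μ : YoungDiagram} (h : μ.colLen 0 ≤ p) :
    (addCol p μ).card = p + μ.card := by
  unfold YoungDiagram.card addCol
  rw [Finset.card_union_of_disjoint]
  · rw [Finset.card_image_of_injective _ fun a b h => congrArg Prod.fst h,
      Finset.card_image_of_injective, Finset.card_range, max_eq_left h]
    rintro ⟨a, b⟩ ⟨c, d⟩ h
    simpa using h
  · rw [Finset.disjoint_left]
    rintro ⟨a, b⟩ h1 h2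
    simp only [Finset.mem_image, Prod.mk.injEq, Prod.exists] at h1 h2
    obtain ⟨_, _, _, rfl⟩ := h1
    obtain ⟨_, _, _, _, h⟩ := h2
    omega

theorem card_dropCol (μ : YoungDiagram) : (dropCol μ).card + μ.colLen 0 = μ.card := by
  conv_rhs => rw [← addCol_dropCol (μ := μ) rfl]
  rw [card_addCol (by simpa using colLen_le_colLen_zero μ 1), add_comm]

theorem colLen_zero_le_card (μ : YoungDiagram) : μ.colLen 0 ≤ μ.card := by
  have := card_dropCol μ
  omega

/-! ### Counting pairs of nested partitions -/

theorem finite_pairs (p q n : ℕ) : {x : YoungDiagram × YoungDiagram | x.1 ≤ x.2 ∧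
    x.1.colLen 0 ≤ q ∧ x.2.colLen 0 ≤ p ∧ x.2.card = n}.Finite := by
  have hfin : (⋃ k ∈ Finset.range (p + 1), {μ : YoungDiagram | length μ = k ∧ μ.card = n}).Finite :=
    Set.Finite.biUnion (Finset.finite_toSet _) fun k _ => finite_partitions k n
  refine (hfin.biUnion (t := fun ν => Set.Iic ν ×ˢ {ν}) fun ν _ =>
    (Set.Finite.prod ?_ (Set.finite_singleton ν))).subset ?_
  · exact (Set.finite_Icc ⊥ ν).subset fun x hx => ⟨bot_le, hx⟩
  · rintro ⟨μ, ν⟩ ⟨h1, -, h3, h4⟩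
    simp only [Set.mem_iUnion, Finset.mem_range]
    exact ⟨ν, ⟨ν.colLen 0, Nat.lt_succ_iff.2 h3, rfl, h4⟩, h1, rfl⟩

/-- The pairs of nested partitions `μ ⊆ ν` with `ν` of size `n`, `μ` of length at most `q` and `ν`
of length at most `p`. -/
noncomputable def nestedPairs (p q n : ℕ) : Finset (YoungDiagram × YoungDiagram) :=
  (finite_pairs p q n).toFinset

theorem mem_nestedPairs {p q n : ℕ} {x : YoungDiagram × YoungDiagram} : x ∈ nestedPairs p q n ↔
    x.1 ≤ x.2 ∧ x.1.colLen 0 ≤ q ∧ x.2.colLen 0 ≤ p ∧ x.2.card = n := by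
  simp [nestedPairs]

/-- Removing the first columns identifies the pairs whose lengths are exactly `q ≤ p` with the pairs
whose lengths are at most `q` and `p`. -/
theorem card_filter_nestedPairs {p q : ℕ} (h : q ≤ p) (n : ℕ) :
    ((nestedPairs p q (n + p)).filter fun x => x.1.colLen 0 = q ∧ x.2.colLen 0 = p).card =
      (nestedPairs p q n).card := by
  refine Finset.card_nbij' (fun x => (dropCol x.1, dropCol x.2))
    (fun x => (addCol q x.1, addCol p x.2)) ?_ ?_ ?_ ?_
  · rintro ⟨μ, ν⟩ hx
    simp only [Finset.coe_filter, mem_nestedPairs, Set.mem_ofPred_eq, Finset.mem_coe] at hx ⊢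
    obtain ⟨⟨h1, h2, h3, h4⟩, h5, h6⟩ := hx
    have := card_dropCol ν
    refine ⟨le_iff_colLen.2 fun j => ?_, ?_, ?_, by omega⟩
    · simpa using le_iff_colLen.1 h1 (j + 1)
    · simpa [← h5] using colLen_le_colLen_zero μ 1
    · simpa [← h6] using colLen_le_colLen_zero ν 1
  · rintro ⟨μ, ν⟩ hx
    simp only [Finset.coe_filter, mem_nestedPairs, Set.mem_ofPred_eq, Finset.mem_coe] at hx ⊢
    obtain ⟨h1, h2, h3, h4⟩ := hx
    refine ⟨⟨le_iff_colLen.2 fun j => ?_, by simp [h2], by simp [h3], ?_⟩, by simp [h2],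
      by simp [h3]⟩
    · rcases j with _ | j
      · simp [h2, h3, h]
      · simpa using le_iff_colLen.1 h1 j
    · rw [card_addCol h3, h4, add_comm]
  · rintro ⟨μ, ν⟩ hx
    simp only [Finset.coe_filter, Set.mem_ofPred_eq] at hx
    exact Prod.ext (addCol_dropCol hx.2.1) (addCol_dropCol hx.2.2)
  · rintro ⟨μ, ν⟩ -
    exact Prod.ext (dropCol_addCol q μ) (dropCol_addCol p ν)

/-- Inclusion–exclusion over the pairs with `ν` shorter than `p + 1` or `μ` shorter than `q + 1`. -/
theorem card_nestedPairs_succ_succ {p q : ℕ} (h : q ≤ p) (n : ℕ) :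
    (nestedPairs (p + 1) (q + 1) (n + (p + 1))).card + (nestedPairs p q (n + (p + 1))).card =
      (nestedPairs p (q + 1) (n + (p + 1))).card + (nestedPairs (p + 1) q (n + (p + 1))).card +
        (nestedPairs (p + 1) (q + 1) n).card := by
  classical
  rw [← card_filter_nestedPairs (Nat.add_le_add_right h 1) n]
  set N := n + (p + 1)
  have hI : nestedPairs p (q + 1) N ∩ nestedPairs (p + 1) q N = nestedPairs p q N := by
    ext x
    simp only [Finset.mem_inter, mem_nestedPairs]
    constructor
    · rintro ⟨⟨h1, h2, h3, h4⟩, -, h6, -, -⟩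
      exact ⟨h1, h6, h3, h4⟩
    · rintro ⟨h1, h2, h3, h4⟩
      exact ⟨⟨h1, by omega, h3, h4⟩, h1, h2, by omega, h4⟩
  have hU : nestedPairs p (q + 1) N ∪ nestedPairs (p + 1) q N =
      (nestedPairs (p + 1) (q + 1) N).filter
        fun x => ¬ (x.1.colLen 0 = q + 1 ∧ x.2.colLen 0 = p + 1) := by
    ext x
    simp only [Finset.mem_union, Finset.mem_filter, mem_nestedPairs]
    constructor
    · rintro (⟨h1, h2, h3, h4⟩ | ⟨h1, h2, h3, h4⟩)
      · exact ⟨⟨h1, by omega, by omega, h4⟩, by omega⟩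
      · exact ⟨⟨h1, by omega, by omega, h4⟩, by omega⟩
    · rintro ⟨⟨h1, h2, h3, h4⟩, h5⟩
      by_cases h6 : x.2.colLen 0 = p + 1
      · exact Or.inr ⟨h1, by omega, h3, h4⟩
      · exact Or.inl ⟨h1, h2, by omega, h4⟩
  have h1 := Finset.card_union_add_card_inter (nestedPairs p (q + 1) N) (nestedPairs (p + 1) q N)
  have h2 := Finset.card_filter_add_card_filter_not (s := nestedPairs (p + 1) (q + 1) N)
    (fun x => x.1.colLen 0 = q + 1 ∧ x.2.colLen 0 = p + 1)
  rw [hI, hU] at h1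
  omega

theorem card_nestedPairs_succ_zero (p n : ℕ) :
    (nestedPairs (p + 1) 0 (n + (p + 1))).card =
      (nestedPairs p 0 (n + (p + 1))).card + (nestedPairs (p + 1) 0 n).card := by
  classical
  rw [← card_filter_nestedPairs (Nat.zero_le _) n]
  have h2 := Finset.card_filter_add_card_filter_not (s := nestedPairs (p + 1) 0 (n + (p + 1)))
    (fun x => x.1.colLen 0 = 0 ∧ x.2.colLen 0 = p + 1)
  rw [← h2, add_comm]
  congr 2
  ext x
  simp only [Finset.mem_filter, mem_nestedPairs]
  constructor
  · rintro ⟨⟨h1, h2, h3, h4⟩, h5⟩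
    exact ⟨h1, h2, by omega, h4⟩
  · rintro ⟨h1, h2, h3, h4⟩
    exact ⟨⟨h1, h2, by omega, h4⟩, by omega⟩

theorem nestedPairs_succ_of_le {p q : ℕ} (h : p ≤ q) (n : ℕ) :
    nestedPairs p (q + 1) n = nestedPairs p q n := by
  ext x
  simp only [mem_nestedPairs]
  constructor
  · rintro ⟨h1, h2, h3, h4⟩
    exact ⟨h1, ((le_iff_colLen.1 h1 0).trans h3).trans h, h3, h4⟩
  · rintro ⟨h1, h2, h3, h4⟩
    exact ⟨h1, by omega, h3, h4⟩

theorem nestedPairs_zero_succ (q n : ℕ) : nestedPairs 0 q (n + 1) = ∅ := by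
  refine Finset.eq_empty_of_forall_notMem fun x hx => ?_
  obtain ⟨-, -, h3, h4⟩ := mem_nestedPairs.1 hx
  rw [eq_bot_iff_colLen_zero.2 (Nat.le_zero.1 h3), YoungDiagram.card, YoungDiagram.cells_bot,
    Finset.card_empty] at h4
  omega

theorem card_nestedPairs_one_zero (n : ℕ) : (nestedPairs 1 0 n).card = 1 := by
  induction n with
  | zero =>
    refine Finset.card_eq_one.2 ⟨(⊥, ⊥), Finset.eq_singleton_iff_unique_mem.2 ⟨?_, ?_⟩⟩
    · simp [mem_nestedPairs, colLen_bot]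
    · rintro ⟨μ, ν⟩ hx
      obtain ⟨-, h2, -, h4⟩ := mem_nestedPairs.1 hx
      have := colLen_zero_le_card ν
      exact Prod.ext (eq_bot_iff_colLen_zero.2 (Nat.le_zero.1 h2))
        (eq_bot_iff_colLen_zero.2 (by dsimp only at h4 ⊢; omega))
  | succ n ih =>
    rw [card_nestedPairs_succ_zero 0 n, nestedPairs_zero_succ, ih, Finset.card_empty]

/-- The pairs with `q = k + 1 = p` that are not pairs with `q = k = p` are the pairs whose larger
member has length exactly `k + 1`, hence are counted by the ideals below the partitions of that
length. -/
theorem sum_card_Icc_bot (k n : ℕ) :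
    ∑ ν ∈ partitions (k + 1) n, (Finset.Icc ⊥ ν).card + (nestedPairs k k n).card =
      (nestedPairs (k + 1) (k + 1) n).card := by
  classical
  have h2 := Finset.card_filter_add_card_filter_not (s := nestedPairs (k + 1) (k + 1) n)
    (fun x => x.2.colLen 0 = k + 1)
  rw [← h2]
  congr 1
  · rw [← Finset.card_sigma]
    refine Finset.card_nbij' (fun x => (x.2, x.1)) (fun x => ⟨x.2, x.1⟩) ?_ ?_ ?_ ?_
    · rintro ⟨ν, μ⟩ hx
      simp only [Finset.coe_sigma, Set.mem_sigma_iff, Finset.mem_coe, mem_partitions, length,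
        Finset.mem_Icc, bot_le, true_and, Finset.mem_filter, mem_nestedPairs] at hx ⊢
      obtain ⟨⟨h1, h2⟩, h3⟩ := hx
      exact ⟨⟨h3, h1 ▸ le_iff_colLen.1 h3 0, h1.le, h2⟩, h1⟩
    · rintro ⟨μ, ν⟩ hx
      simp only [Finset.coe_sigma, Set.mem_sigma_iff, Finset.mem_coe, mem_partitions, length,
        Finset.mem_Icc, bot_le, true_and, Finset.mem_filter, mem_nestedPairs] at hx ⊢
      exact ⟨⟨hx.2, hx.1.2.2.2⟩, hx.1.1⟩
    · intro _ _; rfl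
    · intro _ _; rfl
  · congr 1
    ext x
    simp only [Finset.mem_filter, mem_nestedPairs]
    constructor
    · rintro ⟨h1, h2, h3, h4⟩
      exact ⟨⟨h1, by omega, by omega, h4⟩, by omega⟩
    · rintro ⟨⟨h1, h2, h3, h4⟩, h5⟩
      have := le_iff_colLen.1 h1 0
      exact ⟨h1, by omega, by omega, h4⟩

theorem card_partitions_add (k n : ℕ) :
    (partitions (k + 1) n).card + (nestedPairs k 0 n).card = (nestedPairs (k + 1) 0 n).card := by
  classical
  have h2 := Finset.card_filter_add_card_filter_not (s := nestedPairs (k + 1) 0 n)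
    (fun x => x.2.colLen 0 = k + 1)
  rw [← h2]
  congr 1
  · refine Finset.card_nbij' (fun ν => (⊥, ν)) (fun x => x.2) ?_ ?_ ?_ ?_
    · intro ν hν
      simp only [Finset.mem_coe, mem_partitions, length, Finset.mem_filter, mem_nestedPairs] at hν ⊢
      exact ⟨⟨bot_le, (colLen_bot 0).le, hν.1.le, hν.2⟩, hν.1⟩
    · intro x hx
      simp only [Finset.mem_coe, mem_partitions, length, Finset.mem_filter, mem_nestedPairs] at hx ⊢
      exact ⟨hx.2, hx.1.2.2.2⟩
    · intro _ _; rfl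
    · intro x hx
      simp only [Finset.mem_coe, Finset.mem_filter, mem_nestedPairs] at hx
      exact Prod.ext (eq_bot_iff_colLen_zero.2 (Nat.le_zero.1 hx.1.2.1)).symm rfl
  · congr 1
    ext x
    simp only [Finset.mem_filter, mem_nestedPairs]
    constructor
    · rintro ⟨h1, h2, h3, h4⟩
      exact ⟨⟨h1, h2, by omega, h4⟩, by omega⟩
    · rintro ⟨⟨h1, h2, h3, h4⟩, h5⟩
      exact ⟨h1, h2, by omega, h4⟩

/-! ### A summation lemma of Stolz–Cesàro type -/

theorem tendsto_add_pow_sub_pow_div (p : ℝ) (d : ℕ) :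
    Tendsto (fun n : ℕ => (((n : ℝ) + p) ^ (d + 1) - (n : ℝ) ^ (d + 1)) / (n : ℝ) ^ d) atTop
      (𝓝 (p * (d + 1))) := by
  have h0 : Tendsto (fun n : ℕ => p / (n : ℝ)) atTop (𝓝 0) := tendsto_const_div_atTop_nhds_zero_nat p
  have h1 : Tendsto (fun n : ℕ => (∑ i ∈ Finset.range (d + 1), (1 + p / (n : ℝ)) ^ i) * p) atTop
      (𝓝 ((∑ i ∈ Finset.range (d + 1), (1 + 0 : ℝ) ^ i) * p)) :=
    (tendsto_finsetSum _ fun i _ => (h0.const_add 1).pow i).mul_const p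
  have h2 : (∑ i ∈ Finset.range (d + 1), (1 + 0 : ℝ) ^ i) * p = p * (d + 1) := by
    simp [mul_comm]
  rw [h2] at h1
  refine h1.congr' ?_
  filter_upwards [eventually_gt_atTop 0] with n hn
  have hn' : (n : ℝ) ≠ 0 := by positivity
  rw [eq_div_iff (pow_ne_zero _ hn'), ← geom_sum₂_mul, add_sub_cancel_left, mul_right_comm,
    Finset.sum_mul]
  congr 1
  refine Finset.sum_congr rfl fun i hi => ?_
  have hi' : i ≤ d := Nat.lt_succ_iff.1 (Finset.mem_range.1 hi)
  rw [one_add_div hn', div_pow, div_mul_eq_mul_div, div_eq_iff (pow_ne_zero _ hn'), mul_assoc,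
    ← pow_add, Nat.add_sub_cancel, Nat.sub_add_cancel hi']

/-- If the increments of `H` along steps of length `p` are `o(n ^ d)`, then `H = o(n ^ (d + 1))`. -/
theorem tendsto_div_pow_succ_of_increment {H : ℕ → ℝ} {p : ℕ} (hp : 0 < p) {d : ℕ}
    (h : Tendsto (fun n : ℕ => (H (n + p) - H n) / (n : ℝ) ^ d) atTop (𝓝 0)) :
    Tendsto (fun n : ℕ => H n / (n : ℝ) ^ (d + 1)) atTop (𝓝 0) := by
  rw [Metric.tendsto_atTop] at h
  refine Metric.tendsto_atTop.2 fun ε hε => ?_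
  obtain ⟨N₀, hN₀⟩ := h (ε / 2) (by positivity)
  set M : ℝ := ∑ i ∈ Finset.range (N₀ + 1 + p), |H i|
  -- Walking back in steps of `p` ends below `N₀ + 1 + p`, where `|H|` is at most `M`.
  have key : ∀ n : ℕ, |H n| ≤ M + ε / 2 * (n : ℝ) ^ (d + 1) := by
    intro n
    induction n using Nat.strong_induction_on with
    | _ n ih =>
      by_cases hn : n < N₀ + 1 + p
      · have h1 : |H n| ≤ M :=
          Finset.single_le_sum (f := fun i => |H i|) (fun i _ => abs_nonneg _)
            (Finset.mem_range.2 hn)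
        have : 0 ≤ ε / 2 * (n : ℝ) ^ (d + 1) := by positivity
        linarith
      · obtain ⟨m, rfl⟩ : ∃ m, n = m + p := ⟨n - p, by omega⟩
        have h1 := ih m (by omega)
        have h2 := hN₀ m (by omega)
        have hm : (0 : ℝ) < (m : ℝ) ^ d := by
          have : 0 < m := by omega
          positivity
        rw [Real.dist_eq, sub_zero, abs_div, abs_of_pos hm, div_lt_iff₀ hm] at h2
        have h3 : |H (m + p)| ≤ |H (m + p) - H m| + |H m| := by
          simpa using abs_add_le (H (m + p) - H m) (H m)
        have h4 : (m : ℝ) ^ d + (m : ℝ) ^ (d + 1) ≤ ((m + p : ℕ) : ℝ) ^ (d + 1) := by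
          have hp1 : (1 : ℝ) ≤ p := by exact_mod_cast hp
          calc (m : ℝ) ^ d + (m : ℝ) ^ (d + 1) = (m : ℝ) ^ d * (m + 1) := by ring
            _ ≤ ((m + p : ℕ) : ℝ) ^ d * ((m + p : ℕ) : ℝ) := by
              push_cast
              gcongr
              linarith
            _ = _ := by ring
        nlinarith
  have hM : Tendsto (fun n : ℕ => M / (n : ℝ) ^ (d + 1)) atTop (𝓝 0) :=
    tendsto_const_nhds.div_atTop
      ((tendsto_pow_atTop (Nat.succ_ne_zero d)).comp tendsto_natCast_atTop_atTop)
  obtain ⟨N₁, hN₁⟩ := Metric.tendsto_atTop.1 hM (ε / 2) (by positivity)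
  refine ⟨N₁ + 1, fun n hn => ?_⟩
  have hpos : (0 : ℝ) < (n : ℝ) ^ (d + 1) := by
    have : 0 < n := by omega
    positivity
  have h1 := hN₁ n (by omega)
  have hM0 : 0 ≤ M := Finset.sum_nonneg fun i _ => abs_nonneg _
  rw [Real.dist_eq, sub_zero, abs_of_nonneg (by positivity), div_lt_iff₀ hpos] at h1
  rw [Real.dist_eq, sub_zero, abs_div, abs_of_pos hpos, div_lt_iff₀ hpos]
  linarith [key n]

/-- A discrete integration rule: if `F` increases by `f (n + p) ∼ c n ^ d` from `n` to `n + p`, then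
`F n ∼ c n ^ (d + 1) / (p (d + 1))`. -/
theorem tendsto_div_pow_succ {F f : ℕ → ℝ} {p : ℕ} (hp : 0 < p) {d : ℕ} {c : ℝ}
    (hF : ∀ n, F (n + p) = F n + f (n + p))
    (hf : Tendsto (fun n : ℕ => f n / (n : ℝ) ^ d) atTop (𝓝 c)) :
    Tendsto (fun n : ℕ => F n / (n : ℝ) ^ (d + 1)) atTop (𝓝 (c / (p * (d + 1)))) := by
  have hp' : (p : ℝ) ≠ 0 := by positivity
  set a : ℝ := c / (p * (d + 1))
  have hr : Tendsto (fun n : ℕ => (((n + p : ℕ) : ℝ) / n) ^ d) atTop (𝓝 1) := by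
    have h0 : Tendsto (fun n : ℕ => (1 + (p : ℝ) / (n : ℝ)) ^ d) atTop (𝓝 ((1 + 0) ^ d)) :=
      ((tendsto_const_div_atTop_nhds_zero_nat (p : ℝ)).const_add 1).pow d
    rw [add_zero, one_pow] at h0
    refine h0.congr' ?_
    filter_upwards [eventually_gt_atTop 0] with n hn
    have hn' : (n : ℝ) ≠ 0 := by positivity
    rw [one_add_div hn', Nat.cast_add]
  have hshift : Tendsto (fun n : ℕ => f (n + p) / (n : ℝ) ^ d) atTop (𝓝 c) := by
    have h1 := ((tendsto_add_atTop_iff_nat p).2 hf).mul hr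
    rw [mul_one] at h1
    refine h1.congr' ?_
    filter_upwards [eventually_gt_atTop 0] with n hn
    have hn' : (n : ℝ) ≠ 0 := by positivity
    have hnp : ((n + p : ℕ) : ℝ) ≠ 0 := by positivity
    rw [div_pow]
    field_simp
  have hH := tendsto_div_pow_succ_of_increment (H := fun n => F n - a * (n : ℝ) ^ (d + 1)) hp
    (d := d) (by
      have h1 := hshift.sub ((tendsto_add_pow_sub_pow_div p d).const_mul a)
      have h2 : c - a * (p * (d + 1)) = 0 := by
        have : (d : ℝ) + 1 ≠ 0 := by positivity
        simp only [a]
        field_simp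
        ring
      rw [h2] at h1
      refine h1.congr fun n => ?_
      rw [hF]
      push_cast
      ring)
  have h1 := hH.add_const a
  rw [zero_add] at h1
  refine h1.congr' ?_
  filter_upwards [eventually_gt_atTop 0] with n hn
  have hn' : (n : ℝ) ≠ 0 := by positivity
  field_simp
  ring

/-! ### The weighted sum over diagrams above a staircase -/

theorem finite_aboveStaircase (p q : ℕ) : {μ : YoungDiagram | μ.colLen 0 ≤ p ∧ μ.colLen q = 0 ∧
    ∀ j < q, q - j ≤ μ.colLen j}.Finite := by
  refine (finite_cells_subset (Finset.range p ×ˢ Finset.range q)).subset ?_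
  rintro μ ⟨h1, h2, -⟩ ⟨i, j⟩ hc
  have hc' := YoungDiagram.mem_iff_lt_colLen.1 (show (i, j) ∈ μ from hc)
  have h3 := colLen_le_colLen_zero μ j
  simp only [Finset.mem_product, Finset.mem_range]
  refine ⟨by omega, ?_⟩
  by_contra hj
  have h4 := μ.colLen_anti _ _ (not_lt.1 hj)
  omega

/-- The diagrams with at most `q` columns of height at most `p` that contain the staircase
`(q, q - 1, …, 1)`. -/
noncomputable def aboveStaircase (p q : ℕ) : Finset YoungDiagram :=
  (finite_aboveStaircase p q).toFinset

theorem mem_aboveStaircase {p q : ℕ} {μ : YoungDiagram} : μ ∈ aboveStaircase p q ↔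
    μ.colLen 0 ≤ p ∧ μ.colLen q = 0 ∧ ∀ j < q, q - j ≤ μ.colLen j := by
  simp [aboveStaircase]

/-- The sum over the diagrams between the staircase `(q, q - 1, …, 1)` and the `p × q` rectangle of
the product of the reciprocals of the column heights. -/
noncomputable def staircaseSum (p q : ℕ) : ℝ :=
  ∑ μ ∈ aboveStaircase p q, ∏ j ∈ Finset.range q, ((μ.colLen j : ℝ))⁻¹

theorem staircaseSum_zero_right (p : ℕ) : staircaseSum p 0 = 1 := by
  have : aboveStaircase p 0 = {⊥} := by
    ext μ
    simp only [mem_aboveStaircase, Finset.mem_singleton, eq_bot_iff_colLen_zero]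
    constructor
    · exact fun h => h.2.1
    · intro h
      exact ⟨by omega, h, fun j hj => absurd hj (Nat.not_lt_zero j)⟩
  simp [staircaseSum, this]

theorem staircaseSum_of_lt {p q : ℕ} (h : p < q) : staircaseSum p q = 0 := by
  have : aboveStaircase p q = ∅ := by
    refine Finset.eq_empty_of_forall_notMem fun μ hμ => ?_
    obtain ⟨h1, -, h3⟩ := mem_aboveStaircase.1 hμ
    have := h3 0 (by omega)
    omega
  simp [staircaseSum, this]

/-- Split according to whether the first column has the maximal height `p + 1`; if it does, remove
it. -/
theorem staircaseSum_succ_succ {p q : ℕ} (h : q ≤ p) :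
    staircaseSum (p + 1) (q + 1) = staircaseSum p (q + 1) + staircaseSum (p + 1) q / (p + 1) := by
  classical
  rw [staircaseSum, ← Finset.sum_filter_not_add_sum_filter _ fun μ => μ.colLen 0 = p + 1]
  congr 1
  · rw [staircaseSum]
    refine Finset.sum_congr ?_ fun _ _ => rfl
    ext μ
    simp only [Finset.mem_filter, mem_aboveStaircase]
    constructor
    · rintro ⟨⟨h1, h2, h3⟩, h4⟩
      exact ⟨by omega, h2, h3⟩
    · rintro ⟨h1, h2, h3⟩
      exact ⟨⟨by omega, h2, h3⟩, by omega⟩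
  · rw [staircaseSum, Finset.sum_div]
    refine Finset.sum_nbij' dropCol (addCol (p + 1)) ?_ ?_ ?_ ?_ ?_
    · intro μ hμ
      simp only [Finset.mem_filter, mem_aboveStaircase, colLen_dropCol] at hμ ⊢
      obtain ⟨⟨h1, h2, h3⟩, h4⟩ := hμ
      refine ⟨(colLen_le_colLen_zero μ 1).trans h1, h2, fun j hj => ?_⟩
      have := h3 (j + 1) (by omega)
      omega
    · intro μ hμ
      simp only [Finset.mem_filter, mem_aboveStaircase, colLen_addCol_zero,
        colLen_addCol_succ] at hμ ⊢
      obtain ⟨h1, h2, h3⟩ := hμ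
      refine ⟨⟨by omega, h2, fun j hj => ?_⟩, by omega⟩
      rcases j with _ | j
      · rw [colLen_addCol_zero]
        omega
      · rw [colLen_addCol_succ]
        have := h3 j (by omega)
        omega
    · intro μ hμ
      exact addCol_dropCol (Finset.mem_filter.1 hμ).2
    · intro μ _
      exact dropCol_addCol _ μ
    · intro μ hμ
      have h4 := (Finset.mem_filter.1 hμ).2
      rw [Finset.prod_range_succ', h4]
      simp [div_eq_mul_inv]

/-- Transposition turns rows into columns and fixes both the staircase and the square. -/
theorem sum_Icc_staircase_square (k : ℕ) :
    ∑ μ ∈ Finset.Icc (staircase k) (square k), ∏ i ∈ Finset.range k, ((μ.rowLen i : ℝ))⁻¹ =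
      staircaseSum k k := by
  have hmem (μ : YoungDiagram) :
      μ.transpose ∈ aboveStaircase k k ↔ μ ∈ Finset.Icc (staircase k) (square k) := by
    rw [Finset.mem_Icc, mem_aboveStaircase]
    simp only [YoungDiagram.colLen_transpose, le_iff_rowLen (μ := staircase k), rowLen_staircase]
    constructor
    · rintro ⟨h1, h2, h3⟩
      refine ⟨fun i => ?_, fun c hc => ?_⟩
      · rcases lt_or_ge i k with hi | hi
        · exact h3 i hi
        · omega
      · have hr := YoungDiagram.mem_iff_lt_rowLen.1 (show (c.1, c.2) ∈ μ from hc)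
        have h0 := μ.rowLen_anti 0 c.1 (Nat.zero_le _)
        refine Finset.mem_product.2 ⟨Finset.mem_range.2 ?_, Finset.mem_range.2 (by omega)⟩
        by_contra hk
        have := μ.rowLen_anti k c.1 (not_lt.1 hk)
        omega
    · rintro ⟨h1, h2⟩
      have hs (i j : ℕ) (h : j < μ.rowLen i) : i < k ∧ j < k := by
        have := YoungDiagram.cells_subset_iff.2 h2
          ((YoungDiagram.mem_cells _).2 (YoungDiagram.mem_iff_lt_rowLen.2 h))
        simpa [square] using this
      refine ⟨?_, ?_, fun j _ => h1 j⟩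
      · by_contra h
        exact lt_irrefl k (hs 0 k (not_le.1 h)).2
      · by_contra h
        exact lt_irrefl k (hs k 0 (Nat.pos_of_ne_zero h)).1
  rw [staircaseSum]
  refine Finset.sum_nbij' YoungDiagram.transpose YoungDiagram.transpose
    (fun μ hμ => (hmem μ).2 hμ) (fun μ hμ => (hmem _).1 (by simpa using hμ))
    (fun μ _ => by simp) (fun μ _ => by simp) (fun μ _ => by simp)

theorem staircaseSum_nonneg (p q : ℕ) : 0 ≤ staircaseSum p q :=
  Finset.sum_nonneg fun _ _ => Finset.prod_nonneg fun _ _ => by positivity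

theorem staircaseSum_pos {p q : ℕ} (h : q ≤ p) : 0 < staircaseSum p q := by
  induction q generalizing p with
  | zero => simp [staircaseSum_zero_right]
  | succ q ih =>
    obtain ⟨p, rfl⟩ : ∃ r, p = r + 1 := ⟨p - 1, by omega⟩
    rw [staircaseSum_succ_succ (Nat.succ_le_succ_iff.1 h)]
    have h1 : 0 < staircaseSum (p + 1) q := ih (by omega)
    have h2 := staircaseSum_nonneg p (q + 1)
    positivity

/-! ### Asymptotics of the number of nested pairs -/

theorem tendsto_of_eventually_zero {f : ℕ → ℝ} (hf : ∀ n, f (n + 1) = 0) (d : ℕ) :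
    Tendsto (fun n : ℕ => f n / (n : ℝ) ^ d) atTop (𝓝 0) := by
  refine tendsto_const_nhds.congr' ?_
  filter_upwards [eventually_ge_atTop 1] with n hn
  obtain ⟨m, rfl⟩ : ∃ m, n = m + 1 := ⟨n - 1, by omega⟩
  rw [hf, zero_div]

theorem tendsto_div_pow_succ_zero {f : ℕ → ℝ} {d : ℕ} {c : ℝ}
    (hf : Tendsto (fun n : ℕ => f n / (n : ℝ) ^ d) atTop (𝓝 c)) :
    Tendsto (fun n : ℕ => f n / (n : ℝ) ^ (d + 1)) atTop (𝓝 0) := by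
  simpa [pow_succ, div_mul_eq_div_div] using hf.div_atTop tendsto_natCast_atTop_atTop

theorem tendsto_card_nestedPairs_zero (q d : ℕ) :
    Tendsto (fun n : ℕ => ((nestedPairs 0 q n).card : ℝ) / (n : ℝ) ^ d) atTop (𝓝 0) :=
  tendsto_of_eventually_zero (fun n => by simp [nestedPairs_zero_succ]) d

theorem tendsto_card_nestedPairs_right_zero (p : ℕ) :
    Tendsto (fun n : ℕ => ((nestedPairs (p + 1) 0 n).card : ℝ) / (n : ℝ) ^ p) atTop
      (𝓝 (1 / ((p + 1)! * p !))) := by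
  induction p with
  | zero => simp [card_nestedPairs_one_zero]
  | succ p ih =>
    have h := tendsto_div_pow_succ (F := fun n => ((nestedPairs (p + 1 + 1) 0 n).card : ℝ))
      (Nat.succ_pos (p + 1)) (fun n => by
        rw [Nat.succ_eq_add_one, card_nestedPairs_succ_zero]; push_cast; ring) ih
    convert h using 2
    rw [Nat.factorial_succ (p + 1), Nat.factorial_succ p]
    push_cast
    field_simp

/-- The step of the induction on `p`: the recursion for the number of nested pairs turns into the
recursion for `staircaseSum`, the pairs subtracted by inclusion–exclusion being of lower order. -/
theorem tendsto_card_nestedPairs_step {p : ℕ}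
    (h1 : ∀ q, Tendsto (fun n : ℕ => ((nestedPairs p (q + 1) n).card : ℝ) / (n : ℝ) ^ (p + q)) atTop
      (𝓝 (staircaseSum p (q + 1) / (p ! * (p + q)!))))
    (h2 : ∀ q, Tendsto (fun n : ℕ => ((nestedPairs p q n).card : ℝ) / (n : ℝ) ^ (p + q)) atTop
      (𝓝 0)) (q : ℕ) :
    Tendsto (fun n : ℕ => ((nestedPairs (p + 1) q n).card : ℝ) / (n : ℝ) ^ (p + q)) atTop
      (𝓝 (staircaseSum (p + 1) q / ((p + 1)! * (p + q)!))) := by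
  induction q with
  | zero =>
    rw [staircaseSum_zero_right]
    exact tendsto_card_nestedPairs_right_zero p
  | succ q ih =>
    rcases le_or_gt q p with hq | hq
    · have hf := ((h1 q).add ih).sub (h2 q)
      have h := tendsto_div_pow_succ (F := fun n => ((nestedPairs (p + 1) (q + 1) n).card : ℝ))
        (f := fun n => ((nestedPairs p (q + 1) n).card : ℝ) + ((nestedPairs (p + 1) q n).card : ℝ) -
          ((nestedPairs p q n).card : ℝ))
        (d := p + q) (Nat.succ_pos p) (fun n => by
          have := card_nestedPairs_succ_succ hq n
          rw [Nat.succ_eq_add_one]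
          have h' : ((nestedPairs (p + 1) (q + 1) (n + (p + 1))).card : ℝ) +
            (nestedPairs p q (n + (p + 1))).card = (nestedPairs p (q + 1) (n + (p + 1))).card +
            (nestedPairs (p + 1) q (n + (p + 1))).card + (nestedPairs (p + 1) (q + 1) n).card := by
            exact_mod_cast this
          linarith) (hf.congr fun n => by ring)
      rw [← add_assoc p q 1]
      convert h using 2
      rw [staircaseSum_succ_succ hq, Nat.factorial_succ (p + q),
        Nat.factorial_succ p]
      push_cast
      field_simp
      ring
    · rw [staircaseSum_of_lt (by omega), zero_div, ← add_assoc]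
      simp only [nestedPairs_succ_of_le (show p + 1 ≤ q from hq)]
      exact tendsto_div_pow_succ_zero ih

/-- The number of nested pairs with lengths at most `p + 1` and `q` has order `n ^ (p + q)` when
`q ≤ p + 1`, and lower order, with vanishing `staircaseSum`, otherwise. -/
theorem tendsto_card_nestedPairs (p q : ℕ) :
    Tendsto (fun n : ℕ => ((nestedPairs (p + 1) q n).card : ℝ) / (n : ℝ) ^ (p + q)) atTop
      (𝓝 (staircaseSum (p + 1) q / ((p + 1)! * (p + q)!))) := by
  induction p generalizing q with
  | zero =>
    refine tendsto_card_nestedPairs_step (fun q => ?_)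
      (fun q => tendsto_card_nestedPairs_zero q _) q
    rw [staircaseSum_of_lt (Nat.succ_pos q), zero_div]
    exact tendsto_card_nestedPairs_zero _ _
  | succ p ih =>
    refine tendsto_card_nestedPairs_step (fun q => ?_) (fun q => ?_) q
    · have h := ih (q + 1)
      rwa [← add_assoc, add_right_comm p q 1] at h
    · rw [add_right_comm]
      exact tendsto_div_pow_succ_zero (ih q)

theorem tendsto_sum_card_Icc_bot (p : ℕ) :
    Tendsto (fun n : ℕ => (∑ ν ∈ partitions (p + 1) n, ((Finset.Icc ⊥ ν).card : ℝ)) /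
      (n : ℝ) ^ (2 * p + 1)) atTop
      (𝓝 (staircaseSum (p + 1) (p + 1) / ((p + 1)! * (2 * p + 1)!))) := by
  have h1 := tendsto_card_nestedPairs p (p + 1)
  have h2 : Tendsto (fun n : ℕ => ((nestedPairs p p n).card : ℝ) / (n : ℝ) ^ (2 * p + 1)) atTop
      (𝓝 0) := by
    rcases p with _ | p
    · exact tendsto_card_nestedPairs_zero _ _
    · have h := tendsto_div_pow_succ_zero (tendsto_div_pow_succ_zero
        (tendsto_card_nestedPairs p (p + 1)))
      rwa [show p + (p + 1) + 1 + 1 = 2 * (p + 1) + 1 by ring] at h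
  rw [show p + (p + 1) = 2 * p + 1 by ring] at h1
  have h3 := h1.sub h2
  rw [sub_zero] at h3
  refine h3.congr fun n => ?_
  rw [← sub_div, ← sum_card_Icc_bot]
  push_cast
  ring

theorem tendsto_card_partitions (p : ℕ) :
    Tendsto (fun n : ℕ => ((partitions (p + 1) n).card : ℝ) / (n : ℝ) ^ p) atTop
      (𝓝 (1 / ((p + 1)! * p !))) := by
  have h1 := tendsto_card_nestedPairs_right_zero p
  have h2 : Tendsto (fun n : ℕ => ((nestedPairs p 0 n).card : ℝ) / (n : ℝ) ^ p) atTop (𝓝 0) := by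
    rcases p with _ | p
    · exact tendsto_card_nestedPairs_zero _ _
    · exact tendsto_div_pow_succ_zero (tendsto_card_nestedPairs_right_zero p)
  have h3 := h1.sub h2
  rw [sub_zero] at h3
  refine h3.congr fun n => ?_
  rw [← sub_div, ← card_partitions_add]
  push_cast
  ring

/-- The number of nested pairs grows like `n ^ (2 * p + 1)` and the number of partitions like
`n ^ p`; the factor `(p + 1)!` common to both constants cancels. -/
theorem tendsto_avgIdealCard_div_pow (p : ℕ) :
    Tendsto (fun n : ℕ => avgIdealCard (p + 1) n / (n : ℝ) ^ (p + 1)) atTop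
      (𝓝 (growthConst (p + 1))) := by
  have h := (tendsto_sum_card_Icc_bot p).div (tendsto_card_partitions p) (by positivity)
  have hc : staircaseSum (p + 1) (p + 1) / ((p + 1)! * (2 * p + 1)!) / (1 / ((p + 1)! * p !)) =
      growthConst (p + 1) := by
    rw [growthConst, sum_Icc_staircase_square, Nat.add_sub_cancel,
      show 2 * (p + 1) - 1 = 2 * p + 1 by omega]
    field_simp
  rw [hc] at h
  refine h.congr' ?_
  filter_upwards [eventually_gt_atTop 0] with n hn
  have hn' : (n : ℝ) ≠ 0 := by positivity
  rw [Pi.div_apply, avgIdealCard, div_div_div_eq, div_div, mul_comm ((n : ℝ) ^ (2 * p + 1)),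
    show 2 * p + 1 = p + (p + 1) by ring, pow_add, ← mul_assoc, mul_comm _ ((n : ℝ) ^ p), mul_assoc,
    mul_left_comm _ ((n : ℝ) ^ p), mul_div_mul_left _ _ (pow_ne_zero _ hn')]

theorem growthConst_pos (k : ℕ) : 0 < growthConst k := by
  have := staircaseSum_pos (le_refl k)
  rw [growthConst, sum_Icc_staircase_square]
  positivity

end YoungLattice

theorem theorem2 (k : ℕ) (hk : 1 ≤ k) :
    (fun n : ℕ => YoungLattice.avgIdealCard k n) ~[atTop]
      (fun n : ℕ => YoungLattice.growthConst k * (n : ℝ) ^ k) := by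
  obtain ⟨p, rfl⟩ : ∃ p, k = p + 1 := ⟨k - 1, by omega⟩
  have hpos := YoungLattice.growthConst_pos (p + 1)
  refine (isEquivalent_iff_tendsto_one ?_).2 ?_
  · filter_upwards [eventually_gt_atTop 0] with n hn
    positivity
  · have h := (YoungLattice.tendsto_avgIdealCard_div_pow p).div_const
      (YoungLattice.growthConst (p + 1))
    rw [div_self hpos.ne'] at h
    refine h.congr fun n => ?_
    rw [div_div, mul_comm, Pi.div_apply]
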